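/- For $n\ge 1$ the second-order Eulerian number $C_{n,j}$ is the coefficient of $x^j$ in $C_n(x)=(1-x)^{2n+1}\sum_{r\ge 0}S(n+r,r)\,x^r$, where $S$ denotes the Stirling numbers of the second kind. For $k\ge 1$ let $\mathcal Q_n(k)$ be the set of $k$-Stirling permutations of order $n$, i.e. rearrangements $\sigma=\sigma_1\cdots\sigma_{kn}$ of the multiset $\{1^k,\dots,n^k\}$ in which all entries between two occurrences of $i$ are at least $i$. Put $\sigma_0=\sigma_{kn+1}=0$. For $0\le i\le kn$, the index $i$ is an ascent, a descent or a plateau according as $\sigma_i<\sigma_{i+1}$, $\sigma_i>\sigma_{i+1}$ or $\sigma_i=\sigma_{i+1}$; a plateau $i$ is a $j$-plateau if exactly $j-1$ indices $1\le\ell<i$ satisfy $\sigma_\ell=\sigma_i$. Write $\mathrm{asc}$, $\mathrm{des}$, $\mathrm{plat}_j$ for the numbers of ascents, descents and $j$-plateaux, and let $$C_n(x_1,\dots,x_{k+1})=\sum_{\sigma\in\mathcal Q_n(k)}x_1^{\mathrm{plat}_1(\sigma)}\cdots x_{k-1}^{\mathrm{plat}_{k-1}(\sigma)}\,x_k^{\mathrm{des}(\sigma)}\,x_{k+1}^{\mathrm{asc}(\sigma)}.$$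 Let $e_r$ be the $r$-th elementary symmetric polynomial in $x_1,\dots,x_{k+1}$, with $e_0=1$. Let $n\ge 2$. There is a family of integers $\gamma(n;i_1,\dots,i_n)$, indexed by the sequences of nonnegative integers $(i_1,\dots,i_n)$, which for every integer $k\ge\max(1,n-2)$ is the unique family of integers with $$C_n(x_1,\dots,x_{k+1})=\sum\gamma(n;i_1,\dots,i_n)\,e_{k+1}^{i_1}e_k^{i_2}\cdots e_{k-n+2}^{i_n},$$ where the sum is over the sequences with $i_1+\cdots+i_n=n$, $1\le i_1\le n-1$, $i_n\in\{0,1\}$, and $i_1=n-1$ if $i_n=1$, and $\gamma(n;i_1,\dots,i_n)=0$ for all other sequences. For every $1\le j\le n-1$, $$C_{n-1,j}=\sum_{i_2+\cdots+i_n=n-j}\gamma(n;j,i_2,\dots,i_n),$$ where the sum is over nonnegative integers $i_2,\dots,i_n$. -/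

import Mathlib

namespace StirlingGamma

/-- The set `𝒬ₙ(k)` of `k`-Stirling permutations of order `n`: rearrangements `σ` of the multiset
`{1ᵏ, 2ᵏ, …, nᵏ}` such that every letter standing between two occurrences of `a` is at least `a`
(that is, whenever `a, b, a` is a subsequence of `σ`, one has `a ≤ b`). -/
def stirlingPerms (n k : ℕ) : Finset (List ℕ) :=
  (k • (Finset.Icc 1 n).val).lists.toFinset.filter
    fun σ => ∀ a ∈ σ, ∀ b ∈ σ, List.Sublist [a, b, a] σ → a ≤ b

/-- The letter `σᵢ` of the word `σ = σ₁σ₂⋯σ_N`, with the convention `σ₀ = 0` and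
`σᵢ = 0` for `i > N`. -/
def letter (σ : List ℕ) (i : ℕ) : ℕ := (0 :: σ).getD i 0

/-- The number of ascents: indices `0 ≤ i ≤ N` with `σᵢ < σᵢ₊₁`. -/
def asc (σ : List ℕ) : ℕ :=
  ((Finset.range (σ.length + 1)).filter fun i => letter σ i < letter σ (i + 1)).card

/-- The number of descents: indices `0 ≤ i ≤ N` with `σᵢ > σᵢ₊₁`. -/
def des (σ : List ℕ) : ℕ :=
  ((Finset.range (σ.length + 1)).filter fun i => letter σ (i + 1) < letter σ i).card

/-- The number of `j`-plateaux: indices `i` with `σᵢ = σᵢ₊₁` for which there are exactly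
`j - 1` indices `1 ≤ l < i` with `σₗ = σᵢ`. -/
def plat (j : ℕ) (σ : List ℕ) : ℕ :=
  ((Finset.range (σ.length + 1)).filter fun i => letter σ i = letter σ (i + 1) ∧
    ((Finset.Ico 1 i).filter fun l => letter σ l = letter σ i).card + 1 = j).card

/-- The multivariate `k`-th order Eulerian polynomial `Cₙ(x₁, …, x_{k+1})` (for `k ≥ 1`), the sum
over `σ ∈ 𝒬ₙ(k)` of
`x₁ ^ plat₁(σ) ⋯ x_{k-1} ^ plat_{k-1}(σ) * x_k ^ des(σ) * x_{k+1} ^ asc(σ)`.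
The variable `x_{m+1}` is `X m` for `m : Fin (k + 1)`. -/
noncomputable def eulerianPoly (n k : ℕ) : MvPolynomial (Fin (k + 1)) ℤ :=
  ∑ σ ∈ stirlingPerms n k, ∏ m : Fin (k + 1), MvPolynomial.X m ^
    (if (m : ℕ) = k then asc σ else if (m : ℕ) + 1 = k then des σ else plat ((m : ℕ) + 1) σ)

/-- The index set of the expansion: sequences `(i₁, …, iₙ)` of nonnegative integers with
`i₁ + ⋯ + iₙ = n`, `1 ≤ i₁ ≤ n - 1`, `iₙ ∈ {0, 1}`, and `i₁ = n - 1` if `iₙ = 1`.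
A sequence is stored as a function `ℕ → ℕ` that vanishes outside `{1, …, n}`. -/
def gammaIndex (n : ℕ) : Finset (ℕ → ℕ) :=
  ((Finset.Icc 1 n).piAntidiag n).filter fun i =>
    1 ≤ i 1 ∧ i 1 ≤ n - 1 ∧ (i n = 0 ∨ i n = 1) ∧ (i n = 1 → i 1 = n - 1)

/-- `γ` is a family of coefficients of an expansion of `Cₙ(x₁, …, x_{k+1})` in the elementary
symmetric polynomials `e_r` of `x₁, …, x_{k+1}`:
`Cₙ = ∑ γ(i₁, …, iₙ) e_{k+1} ^ i₁ * e_k ^ i₂ ⋯ e_{k-n+2} ^ iₙ`, the sum being over the sequences in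
`gammaIndex n`; all other values of `γ` are `0`. (This is used for `k ≥ n - 2`, so
that the subscripts `k + 2 - m`, `1 ≤ m ≤ n`, are true differences.) -/
def IsGammaExpansion (n k : ℕ) (γ : (ℕ → ℕ) → ℤ) : Prop :=
  (∀ i, i ∉ gammaIndex n → γ i = 0) ∧
  eulerianPoly n k = ∑ i ∈ gammaIndex n, MvPolynomial.C (γ i) *
    ∏ m ∈ Finset.Icc 1 n, MvPolynomial.esymm (Fin (k + 1)) ℤ (k + 2 - m) ^ i m

/-- The second-order Eulerian number `C_{n,j}`: the coefficient of `x ^ j` in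
`Cₙ(x) = (1 - x) ^ (2n + 1) * ∑_{r ≥ 0} S(n + r, r) x ^ r`, where `S` denotes the Stirling numbers
of the second kind. -/
noncomputable def secondOrderEulerian (n j : ℕ) : ℤ :=
  PowerSeries.coeff j
    ((1 - PowerSeries.X) ^ (2 * n + 1) *
      PowerSeries.mk fun r => (Nat.stirlingSecond (n + r) r : ℤ))

end StirlingGamma

namespace StirlingGamma

open MvPolynomial

/-! Building a `k`-Stirling permutation by inserting the block of `k` largest letters into a gap
erases that gap's variable and creates each of `x_1, …, x_{k+1}` exactly once. Hence `C_{n+1} =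
e_{k+1} · ∂C_n`, with `∂` the sum of all partial derivatives (`eulerianPoly_succ`). Since `∂
e_{k+2-m} = m e_{k+1-m}`, the substitution `y_m ↦ e_{k+2-m}` turns the derivation `y_m ↦ m y_1
y_{m+1}`, which does not mention `k`, into `e_{k+1} ∂` (`toEsymm_grammarDeriv`). Iterating it on
`y_1` gives a universal polynomial whose coefficients serve as `γ` for every `k` at once.

Its gradings confine the exponents to the prescribed index set (`coe_mem_gammaIndex`), and algebraic
independence of the elementary symmetric polynomials gives uniqueness (`IsGammaExpansion.unique`).

Putting `y_1 = x` and every other `y_m = 1` collects the coefficients by `i_1`. The result satisfies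
the first-order differential recurrence of the second-order Eulerian polynomials
(`secondOrderEulerian_eq_coeff`). -/

/-! ### The universal polynomial and its gradings. -/

/-- The derivation `y_m ↦ m y_1 y_{m+1}` of `ℤ[y_0, y_1, …]`. -/
noncomputable def grammarDeriv : Derivation ℤ (MvPolynomial ℕ ℤ) (MvPolynomial ℕ ℤ) :=
  mkDerivation ℤ fun m => (m : MvPolynomial ℕ ℤ) * (X 1 * X (m + 1))

/-- The universal polynomial whose coefficients are the numbers `γ(n + 1; i_1, …, i_{n+1})`. -/
noncomputable def gammaPoly (n : ℕ) : MvPolynomial ℕ ℤ := grammarDeriv^[n] (X 1)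

lemma grammarDeriv_X (m : ℕ) :
    grammarDeriv (X m) = (m : MvPolynomial ℕ ℤ) * (X 1 * X (m + 1)) := by
  simp [grammarDeriv]

lemma gammaPoly_zero : gammaPoly 0 = X 1 := rfl

lemma gammaPoly_succ (n : ℕ) : gammaPoly (n + 1) = grammarDeriv (gammaPoly n) :=
  Function.iterate_succ_apply' _ _ _

/-- By the Leibniz rule, each term of the image of a monomial trades one factor `X i` for `f i`, a
gain of weight `e`. -/
lemma isWeightedHomogeneous_mkDerivation {σ R M : Type*} [CommSemiring R] [AddCommMonoid M]
    {w : σ → M} {f : σ → MvPolynomial σ R} {d e : M}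
    (hf : ∀ m, IsWeightedHomogeneous w (f m) (w m + e)) {F : MvPolynomial σ R}
    (hF : IsWeightedHomogeneous w F d) :
    IsWeightedHomogeneous w (mkDerivation R f F) (d + e) := by
  classical
  rw [F.as_sum, map_sum]
  refine IsWeightedHomogeneous.sum _ _ _ fun s hs => ?_
  have hs' := hF (mem_support_iff.1 hs)
  rw [mkDerivation_monomial]
  refine Submodule.smul_mem (weightedHomogeneousSubmodule R w (d + e)) _ ?_
  refine Submodule.sum_mem (weightedHomogeneousSubmodule R w (d + e)) fun i hi => ?_
  have h1 : IsWeightedHomogeneous w (monomial (s - Finsupp.single i 1) ((s i : ℕ) : R))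
      (Finsupp.weight w (s - Finsupp.single i 1)) := isWeightedHomogeneous_monomial _ _ _ rfl
  have h2 := h1.mul (hf i)
  have h3 : Finsupp.weight w (s - Finsupp.single i 1) + w i = d := by
    rw [← hs']
    conv_rhs => rw [← Finsupp.sub_add_single_one_cancel (Finsupp.mem_support_iff.1 hi)]
    rw [map_add, Finsupp.weight_single, one_smul]
  rw [← add_assoc, h3] at h2
  exact h2

/-- The weight recording the degree, the sum of the indices, and the occurrences of `y_0`. -/
def tripleWeight (m : ℕ) : ℕ × ℕ × ℕ := (1, m, if m = 0 then 1 else 0)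

lemma isWeightedHomogeneous_gammaPoly (n : ℕ) :
    IsWeightedHomogeneous tripleWeight (gammaPoly n) (n + 1, 2 * n + 1, 0) := by
  induction n with
  | zero => exact isWeightedHomogeneous_X _ _ _
  | succ n ih =>
    rw [gammaPoly_succ]
    -- Replacing `y_m` by `y_1 y_{m+1}` adds one to the degree and two to the index sum; `y_0` is
    -- sent to zero and never created.
    refine isWeightedHomogeneous_mkDerivation (e := (1, 2, 0)) (fun m => ?_) ih
    rcases Nat.eq_zero_or_pos m with rfl | hm
    · simpa using isWeightedHomogeneous_zero ℤ tripleWeight _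
    · have h1 := ((isWeightedHomogeneous_X ℤ tripleWeight 1).mul
        (isWeightedHomogeneous_X ℤ tripleWeight (m + 1)))
      have h2 := (isWeightedHomogeneous_C tripleWeight (m : ℤ)).mul h1
      have : (C (m : ℤ) : MvPolynomial ℕ ℤ) = (m : MvPolynomial ℕ ℤ) := by simp
      rw [this] at h2
      convert h2 using 1
      simp [tripleWeight, hm.ne']
      omega

lemma weight_tripleWeight (s : ℕ →₀ ℕ) :
    Finsupp.weight tripleWeight s = (s.sum fun _ a => a, s.sum fun m a => a * m, s 0) := by
  have h0 : s 0 = s.sum fun m a => a * if m = 0 then 1 else 0 := by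
    classical
    simp [Finsupp.sum]
  rw [h0, Finsupp.weight_apply]
  simp only [Finsupp.sum, Prod.ext_iff, Prod.fst_sum, Prod.snd_sum, tripleWeight]
  simp

/-! ### Specialisation to the second-order Eulerian numbers. -/

/-- The derivation `y_m ↦ m y_m`. -/
noncomputable def indexDeriv : Derivation ℤ (MvPolynomial ℕ ℤ) (MvPolynomial ℕ ℤ) :=
  mkDerivation ℤ fun m => (m : MvPolynomial ℕ ℤ) * X m

lemma indexDeriv_X (m : ℕ) : indexDeriv (X m) = (m : MvPolynomial ℕ ℤ) * X m := by
  simp [indexDeriv]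

/-- The commutator is again a derivation, so the identity need only be checked on variables, where
the index sum grows by two. -/
lemma indexDeriv_grammarDeriv (F : MvPolynomial ℕ ℤ) :
    indexDeriv (grammarDeriv F) = grammarDeriv (indexDeriv F) + 2 * grammarDeriv F := by
  have h : ⁅indexDeriv, grammarDeriv⁆ = (2 : ℤ) • grammarDeriv := by
    refine derivation_ext fun m => ?_
    simp only [Derivation.commutator_apply, Derivation.smul_apply, indexDeriv_X, grammarDeriv_X,
      Derivation.leibniz, Derivation.map_natCast, smul_eq_mul, zsmul_eq_mul]
    push_cast
    ring
  have h' := DFunLike.congr_fun h F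
  rw [Derivation.commutator_apply, Derivation.smul_apply, zsmul_eq_mul] at h'
  push_cast at h'
  linear_combination h'

lemma indexDeriv_gammaPoly (n : ℕ) : indexDeriv (gammaPoly n) = (2 * n + 1) * gammaPoly n := by
  induction n with
  | zero => simp [gammaPoly_zero, indexDeriv_X]
  | succ n ih =>
    have h2 : grammarDeriv (2 * (n : MvPolynomial ℕ ℤ) + 1) = 0 := by
      have := grammarDeriv.map_natCast (2 * n + 1)
      push_cast at this
      exact this
    rw [gammaPoly_succ, indexDeriv_grammarDeriv, ih, Derivation.leibniz, h2]
    simp only [smul_eq_mul]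
    push_cast
    ring

/-- The specialisation `y_1 ↦ x`, `y_m ↦ 1` for `m ≠ 1`. -/
noncomputable def specialise : MvPolynomial ℕ ℤ →ₐ[ℤ] PowerSeries ℤ :=
  aeval fun m => if m = 1 then PowerSeries.X else 1

lemma specialise_X (m : ℕ) : specialise (X m) = if m = 1 then PowerSeries.X else 1 := by
  simp [specialise]

/-- Both sides obey the Leibniz rule along `specialise`. On `y_1` the identity reads `x = x(1 - x) +
x · x`, and on any other `y_m` it reads `m x = 0 + x · m`. -/
lemma specialise_grammarDeriv (F : MvPolynomial ℕ ℤ) :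
    specialise (grammarDeriv F) =
      PowerSeries.X * (1 - PowerSeries.X) * PowerSeries.derivative ℤ (specialise F) +
        PowerSeries.X * specialise (indexDeriv F) := by
  induction F using MvPolynomial.induction_on with
  | C a =>
    have : (C a : MvPolynomial ℕ ℤ) = algebraMap ℤ _ a := rfl
    simp [this, Derivation.map_algebraMap]
  | add p q hp hq =>
    simp only [map_add, hp, hq]
    ring
  | mul_X p m hp =>
    simp only [Derivation.leibniz, map_add, map_mul, smul_eq_mul, hp, grammarDeriv_X,
      indexDeriv_X, specialise_X, map_natCast]
    by_cases h1 : m = 1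
    · subst h1
      simp; ring
    · rcases Nat.eq_zero_or_pos m with rfl | hm
      · simp
      · simp [h1, show m ≠ 0 by omega]
        ring

lemma specialise_gammaPoly_succ (n : ℕ) :
    specialise (gammaPoly (n + 1)) =
      PowerSeries.X * (1 - PowerSeries.X) * PowerSeries.derivative ℤ (specialise (gammaPoly n)) +
        (2 * (n : PowerSeries ℤ) + 1) * PowerSeries.X * specialise (gammaPoly n) := by
  rw [gammaPoly_succ, specialise_grammarDeriv, indexDeriv_gammaPoly]
  simp only [map_mul, map_add, map_one, map_natCast, map_ofNat]
  ring

/-- The generating function `∑ S(n + r, r) x ^ r`. -/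
noncomputable def stirlingSeries (n : ℕ) : PowerSeries ℤ :=
  PowerSeries.mk fun r => (Nat.stirlingSecond (n + r) r : ℤ)

/-- Coefficientwise this is the recurrence `S(N+1, r) = r S(N, r) + S(N, r-1)`. -/
lemma stirlingSeries_succ (n : ℕ) :
    (1 - PowerSeries.X) * stirlingSeries (n + 1) =
      PowerSeries.X * PowerSeries.derivative ℤ (stirlingSeries n) := by
  ext r
  rw [sub_mul, one_mul, map_sub]
  cases r with
  | zero => simp [stirlingSeries]
  | succ r =>
    rw [PowerSeries.coeff_succ_X_mul, PowerSeries.coeff_succ_X_mul, PowerSeries.coeff_derivative]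
    simp only [stirlingSeries, PowerSeries.coeff_mk]
    rw [show n + 1 + (r + 1) = (n + (r + 1)) + 1 by ring, Nat.stirlingSecond_succ_succ,
      show n + 1 + r = n + (r + 1) by ring]
    push_cast
    ring

/-- The differential recurrences of the two sides agree. The order is shifted by one because order
zero fails: `gammaPoly 0` specialises to `x`, while `(1 - x) ∑ x^r = 1`. -/
lemma secondOrderEulerian_eq_coeff (n j : ℕ) :
    secondOrderEulerian (n + 1) j = PowerSeries.coeff j (specialise (gammaPoly (n + 1))) := by
  suffices h : ∀ n, specialise (gammaPoly (n + 1)) =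
      (1 - PowerSeries.X) ^ (2 * (n + 1) + 1) * stirlingSeries (n + 1) by
    rw [h]
    rfl
  intro n
  induction n with
  | zero =>
    have h0 : (1 - PowerSeries.X) * stirlingSeries 0 = 1 := by
      have : stirlingSeries 0 = PowerSeries.mk 1 := by
        ext r
        simp [stirlingSeries, Nat.stirlingSecond_self]
      rw [this, mul_comm, PowerSeries.mk_one_mul_one_sub_eq_one]
    have h1 := stirlingSeries_succ 0
    have h2 := congrArg (PowerSeries.derivative ℤ) h0
    rw [Derivation.leibniz] at h2
    simp only [map_sub, Derivation.map_one_eq_zero, PowerSeries.derivative_X, smul_eq_mul] at h2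
    rw [specialise_gammaPoly_succ, gammaPoly_zero, specialise_X]
    simp only [if_true, PowerSeries.derivative_X]
    push_cast
    linear_combination (-(1 - PowerSeries.X) ^ 2) * h1 -
      PowerSeries.X * (1 - PowerSeries.X) * h2 - PowerSeries.X * h0
  | succ n ih =>
    have h1 := stirlingSeries_succ (n + 1)
    rw [specialise_gammaPoly_succ, ih, Derivation.leibniz, Derivation.leibniz_pow]
    simp only [map_sub, Derivation.map_one_eq_zero, PowerSeries.derivative_X, smul_eq_mul,
      nsmul_eq_mul, Nat.add_sub_cancel]
    push_cast
    linear_combination (-(1 - PowerSeries.X) ^ (2 * n + 4)) * h1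

/-! ### The total derivative on elementary symmetric polynomials. -/

lemma _root_.Derivation.map_finset_prod {R A ι : Type*} [CommSemiring R] [CommSemiring A]
    [Algebra R A] [DecidableEq ι] (D : Derivation R A A) (s : Finset ι) (f : ι → A) :
    D (∏ i ∈ s, f i) = ∑ i ∈ s, (∏ j ∈ s.erase i, f j) * D (f i) := by
  induction s using Finset.induction_on with
  | empty => simp
  | insert a s ha ih =>
    rw [Finset.prod_insert ha, Derivation.leibniz, ih, Finset.sum_insert ha,
      Finset.erase_insert ha, smul_eq_mul, smul_eq_mul, add_comm, Finset.mul_sum]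
    congr 1
    refine Finset.sum_congr rfl fun i hi => ?_
    rw [Finset.erase_insert_of_ne (by rintro rfl; exact ha hi),
      Finset.prod_insert (by simp [ha]), mul_assoc]

/-- The sum of all partial derivatives. -/
noncomputable def totalDeriv (σ : Type*) :
    Derivation ℤ (MvPolynomial σ ℤ) (MvPolynomial σ ℤ) :=
  mkDerivation ℤ fun _ => 1

lemma totalDeriv_X {σ : Type*} (i : σ) : totalDeriv σ (X i) = 1 := by
  simp [totalDeriv]

lemma totalDeriv_esymm_zero {σ : Type*} [Fintype σ] : totalDeriv σ (esymm σ ℤ 0) = 0 := by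
  rw [esymm_zero, Derivation.map_one_eq_zero]

/-- Double counting: an `r`-subset arises by deleting a point from an `(r+1)`-subset once for each
element of its complement. -/
lemma totalDeriv_esymm_succ {σ : Type*} [Fintype σ] (r : ℕ) :
    totalDeriv σ (esymm σ ℤ (r + 1)) =
      ((Fintype.card σ - r : ℕ) : MvPolynomial σ ℤ) * esymm σ ℤ r := by
  classical
  have h : ∀ u ∈ Finset.powersetCard r (Finset.univ : Finset σ),
      ((Fintype.card σ - r : ℕ) : MvPolynomial σ ℤ) * ∏ i ∈ u, X i =
        ∑ _i ∈ uᶜ, ∏ i ∈ u, (X i : MvPolynomial σ ℤ) := by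
    intro u hu
    rw [Finset.sum_const, nsmul_eq_mul, Finset.card_compl, (Finset.mem_powersetCard.1 hu).2]
  rw [esymm, esymm, map_sum, Finset.mul_sum, Finset.sum_congr rfl h]
  simp only [Derivation.map_finset_prod, totalDeriv_X, mul_one]
  rw [Finset.sum_sigma', Finset.sum_sigma']
  refine Finset.sum_bij' (fun p _ => ⟨p.1.erase p.2, p.2⟩) (fun p _ => ⟨insert p.2 p.1, p.2⟩)
    ?_ ?_ ?_ ?_ ?_
  · rintro ⟨t, i⟩ h
    simp only [Finset.mem_sigma, Finset.mem_powersetCard, Finset.subset_univ, true_and] at h ⊢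
    simp [Finset.card_erase_of_mem h.2, h.1]
  · rintro ⟨t, i⟩ h
    simp only [Finset.mem_sigma, Finset.mem_powersetCard, Finset.subset_univ, true_and,
      Finset.mem_compl] at h ⊢
    simp [Finset.card_insert_of_notMem h.2, h.1]
  · rintro ⟨t, i⟩ h
    simp only [Finset.mem_sigma] at h
    simp [Finset.insert_erase h.2]
  · rintro ⟨t, i⟩ h
    simp only [Finset.mem_sigma, Finset.mem_compl] at h
    simp [Finset.erase_insert h.2]
  · rintro ⟨t, i⟩ h
    rfl

/-- The specialisation `y_m ↦ e_{k+2-m}`, where `e_r = 0` for `r < 0`. -/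
noncomputable def toEsymm (k : ℕ) : MvPolynomial ℕ ℤ →ₐ[ℤ] MvPolynomial (Fin (k + 1)) ℤ :=
  aeval fun m => if m ≤ k + 2 then esymm (Fin (k + 1)) ℤ (k + 2 - m) else 0

lemma toEsymm_X (k m : ℕ) :
    toEsymm k (X m) = if m ≤ k + 2 then esymm (Fin (k + 1)) ℤ (k + 2 - m) else 0 := by
  simp [toEsymm]

lemma toEsymm_grammarDeriv (k : ℕ) (F : MvPolynomial ℕ ℤ) :
    toEsymm k (grammarDeriv F) =
      esymm (Fin (k + 1)) ℤ (k + 1) * totalDeriv (Fin (k + 1)) (toEsymm k F) := by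
  induction F using MvPolynomial.induction_on with
  | C a =>
    have : (C a : MvPolynomial ℕ ℤ) = algebraMap ℤ _ a := rfl
    simp [this, Derivation.map_algebraMap]
  | add p q hp hq =>
    simp only [map_add, hp, hq]
    ring
  | mul_X p m hp =>
    have hX : toEsymm k (grammarDeriv (X m)) =
        esymm (Fin (k + 1)) ℤ (k + 1) * totalDeriv (Fin (k + 1)) (toEsymm k (X m)) := by
      rw [grammarDeriv_X]
      simp only [map_mul, map_natCast, toEsymm_X]
      rw [if_pos (by omega : 1 ≤ k + 2), show k + 2 - 1 = k + 1 by omega]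
      -- The boundary case `m = k + 2` is `e_0 = 1`: its derivative vanishes, matching the
      -- convention that `y_{k+3}` goes to zero.
      rcases lt_trichotomy m (k + 2) with h | rfl | h
      · rw [if_pos (by omega), if_pos (by omega), show k + 2 - m = (k + 1 - m) + 1 by omega,
          totalDeriv_esymm_succ, Fintype.card_fin, show k + 2 - (m + 1) = k + 1 - m by omega,
          show k + 1 - (k + 1 - m) = m by omega]
        ring
      · rw [if_neg (by omega), if_pos le_rfl, Nat.sub_self, totalDeriv_esymm_zero]
        simp
      · rw [if_neg (by omega), if_neg (by omega)]
        simp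
    simp only [Derivation.leibniz, map_add, map_mul, smul_eq_mul, hp, hX]
    ring

/-! ### Support of the universal polynomial and extraction of its coefficients. -/

/-- The exponent vector of `y_1 ^ i_1 ⋯ y_n ^ i_n`. -/
noncomputable def toExponent (n : ℕ) (i : ℕ → ℕ) : ℕ →₀ ℕ :=
  ∑ m ∈ Finset.Icc 1 n, Finsupp.single m (i m)

lemma prod_X_pow_eq_monomial_toExponent (n : ℕ) (i : ℕ → ℕ) :
    ∏ m ∈ Finset.Icc 1 n, (X m : MvPolynomial ℕ ℤ) ^ i m = monomial (toExponent n i) 1 := by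
  simp only [X_pow_eq_monomial, toExponent, monomial_sum_one]

lemma mem_gammaIndex {n : ℕ} {i : ℕ → ℕ} :
    i ∈ gammaIndex n ↔ ((∑ m ∈ Finset.Icc 1 n, i m = n) ∧ ∀ m, i m ≠ 0 → m ∈ Finset.Icc 1 n) ∧
      1 ≤ i 1 ∧ i 1 ≤ n - 1 ∧ (i n = 0 ∨ i n = 1) ∧ (i n = 1 → i 1 = n - 1) := by
  rw [gammaIndex, Finset.mem_filter, Finset.mem_piAntidiag]

lemma toExponent_apply_of_mem {n : ℕ} {i : ℕ → ℕ} (hi : i ∈ gammaIndex n) :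
    ⇑(toExponent n i) = i := by
  funext m
  rw [toExponent, Finsupp.finsetSum_apply]
  simp only [Finsupp.single_apply]
  rw [Finset.sum_ite_eq' (Finset.Icc 1 n) m i]
  split_ifs with h
  · rfl
  · by_contra h0
    exact h ((mem_gammaIndex.1 hi).1.2 m (Ne.symm h0))

/-- The gradings give `s 0 = 0`, `∑ s m = n` and `∑ (m - 1) s m = n - 1`. All the constraints of the
index set follow from these equations by estimating the indices strictly between `1` and `n`. -/
lemma coe_mem_gammaIndex {n : ℕ} (hn : 2 ≤ n) {s : ℕ →₀ ℕ}
    (hs : coeff s (gammaPoly (n - 1)) ≠ 0) : ⇑s ∈ gammaIndex n := by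
  have hw := isWeightedHomogeneous_gammaPoly (n - 1) hs
  rw [weight_tripleWeight] at hw
  simp only [Prod.mk.injEq] at hw
  obtain ⟨h1, h2, h0⟩ := hw
  have h3 : ∑ m ∈ s.support, s m * (m - 1) = n - 1 := by
    have : ∑ m ∈ s.support, s m * m = ∑ m ∈ s.support, s m * (m - 1) + ∑ m ∈ s.support, s m := by
      rw [← Finset.sum_add_distrib]
      refine Finset.sum_congr rfl fun m hm => ?_
      obtain ⟨t, rfl⟩ : ∃ t, m = t + 1 := Nat.exists_eq_succ_of_ne_zero (by
        rintro rfl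
        exact Finsupp.mem_support_iff.1 hm h0)
      simp
      ring
    simp only [Finsupp.sum] at h1 h2
    omega
  have hsub : s.support ⊆ Finset.Icc 1 n := by
    intro m hm
    have hm0 : s m ≠ 0 := Finsupp.mem_support_iff.1 hm
    have hle : s m * (m - 1) ≤ n - 1 :=
      h3 ▸ Finset.single_le_sum (f := fun m => s m * (m - 1)) (fun _ _ => Nat.zero_le _) hm
    have : 1 * (m - 1) ≤ s m * (m - 1) := Nat.mul_le_mul_right _ (by omega)
    have hmz : m ≠ 0 := by
      rintro rfl
      exact hm0 h0
    rw [Finset.mem_Icc]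
    omega
  have hext : ∀ f : ℕ → ℕ, ∑ m ∈ Finset.Icc 1 n, s m * f m = ∑ m ∈ s.support, s m * f m := by
    intro f
    refine (Finset.sum_subset hsub fun m _ hm => ?_).symm
    rw [Finsupp.notMem_support_iff.1 hm, zero_mul]
  have hsum : ∑ m ∈ Finset.Icc 1 n, s m = n := by
    have := hext fun _ => 1
    simp only [mul_one] at this
    simp only [Finsupp.sum] at h1
    omega
  have hwt : ∑ m ∈ Finset.Icc 1 n, s m * (m - 1) = n - 1 := by rw [hext, h3]
  have hmem1 : 1 ∈ Finset.Icc 1 n := by simp; omega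
  have hmemn : n ∈ (Finset.Icc 1 n).erase 1 := by simp; omega
  have e1 := hsum
  rw [← Finset.add_sum_erase _ _ hmem1, ← Finset.add_sum_erase _ _ hmemn] at e1
  have e2 := hwt
  rw [← Finset.add_sum_erase _ _ hmem1, ← Finset.add_sum_erase _ _ hmemn] at e2
  set T := ((Finset.Icc 1 n).erase 1).erase n
  have hT : ∀ m ∈ T, 2 ≤ m ∧ m ≤ n := by
    intro m hm
    simp only [T, Finset.mem_erase, Finset.mem_Icc] at hm
    omega
  -- This bound yields `s 1 ≥ 1`, and it empties the middle range when `s n = 1`; the next one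
  -- yields `s 1 ≤ n - 1` when `s n = 0`.
  have l1 : ∑ m ∈ T, s m ≤ ∑ m ∈ T, s m * (m - 1) := by
    refine Finset.sum_le_sum fun m hm => ?_
    exact Nat.le_mul_of_pos_right _ (by have := hT m hm; omega)
  have l2 : ∑ m ∈ T, s m * (m - 1) ≤ (∑ m ∈ T, s m) * (n - 1) := by
    rw [Finset.sum_mul]
    refine Finset.sum_le_sum fun m hm => Nat.mul_le_mul_left _ ?_
    have := hT m hm
    omega
  rw [mem_gammaIndex]
  refine ⟨⟨hsum, fun m hm => hsub (Finsupp.mem_support_iff.2 hm)⟩, ?_⟩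
  simp only [Nat.sub_self, mul_zero, zero_add] at e2
  generalize ∑ m ∈ T, s m * (m - 1) = d at *
  generalize ∑ m ∈ T, s m = c at *
  have hb : s n ≤ 1 := by
    by_contra hb
    have : 2 * (n - 1) ≤ s n * (n - 1) := Nat.mul_le_mul_right _ (by omega)
    omega
  interval_cases s n
  · have : c ≠ 0 := by
      rintro rfl
      omega
    omega
  · omega

open Classical in
/-- The coefficients `γ(n; i_1, …, i_n)`. -/
noncomputable def gammaCoeff (n : ℕ) (i : ℕ → ℕ) : ℤ :=
  if i ∈ gammaIndex n then coeff (toExponent n i) (gammaPoly (n - 1)) else 0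

lemma gammaCoeff_of_notMem {n : ℕ} {i : ℕ → ℕ} (hi : i ∉ gammaIndex n) : gammaCoeff n i = 0 :=
  if_neg hi

lemma gammaPoly_eq_sum {n : ℕ} (hn : 2 ≤ n) :
    gammaPoly (n - 1) = ∑ i ∈ gammaIndex n, C (gammaCoeff n i) *
      ∏ m ∈ Finset.Icc 1 n, X m ^ i m := by
  ext s
  rw [coeff_sum]
  simp only [prod_X_pow_eq_monomial_toExponent, coeff_C_mul, coeff_monomial]
  by_cases hs : ⇑s ∈ gammaIndex n
  · have he : toExponent n s = s := DFunLike.coe_injective (toExponent_apply_of_mem hs)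
    rw [Finset.sum_eq_single_of_mem _ hs, if_pos he, gammaCoeff, if_pos hs, he, mul_one]
    intro i hi hne
    rw [if_neg, mul_zero]
    rintro rfl
    exact hne (toExponent_apply_of_mem hi).symm
  · rw [Finset.sum_eq_zero, not_ne_iff.1 (mt (coe_mem_gammaIndex hn) hs)]
    intro i hi
    rw [if_neg, mul_zero]
    rintro rfl
    rw [toExponent_apply_of_mem hi] at hs
    exact hs hi

lemma toEsymm_gammaPoly {n k : ℕ} (hn : 2 ≤ n) (hk : n ≤ k + 2) :
    toEsymm k (gammaPoly (n - 1)) = ∑ i ∈ gammaIndex n, C (gammaCoeff n i) *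
      ∏ m ∈ Finset.Icc 1 n, esymm (Fin (k + 1)) ℤ (k + 2 - m) ^ i m := by
  rw [gammaPoly_eq_sum hn, map_sum]
  refine Finset.sum_congr rfl fun i _ => ?_
  rw [map_mul, map_prod, ← algebraMap_eq, AlgHom.commutes, algebraMap_eq]
  congr 1
  refine Finset.prod_congr rfl fun m hm => ?_
  rw [map_pow, toEsymm_X, if_pos ((Finset.mem_Icc.1 hm).2.trans hk)]

lemma secondOrderEulerian_eq_sum {n : ℕ} (hn : 2 ≤ n) {j : ℕ} (hjn : j ≤ n - 1) :
    secondOrderEulerian (n - 1) j =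
      ∑ i ∈ (Finset.Icc 2 n).piAntidiag (n - j), gammaCoeff n (Function.update i 1 j) := by
  obtain ⟨n, rfl⟩ : ∃ t, n = t + 2 := ⟨n - 2, by omega⟩
  have hIcc : Finset.Icc 1 (n + 2) = insert 1 (Finset.Icc 2 (n + 2)) := by
    ext m
    simp only [Finset.mem_Icc, Finset.mem_insert]
    omega
  have h1 : (1 : ℕ) ∉ Finset.Icc 2 (n + 2) := by simp
  rw [show n + 2 - 1 = n + 1 by omega, secondOrderEulerian_eq_coeff]
  have hG := gammaPoly_eq_sum hn
  rw [show n + 2 - 1 = n + 1 by omega] at hG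
  rw [hG, map_sum, map_sum]
  have hterm : ∀ i : ℕ → ℕ, PowerSeries.coeff j (specialise (C (gammaCoeff (n + 2) i) *
      ∏ m ∈ Finset.Icc 1 (n + 2), X m ^ i m)) = if i 1 = j then gammaCoeff (n + 2) i else 0 := by
    intro i
    rw [map_mul, map_prod, hIcc, Finset.prod_insert h1, Finset.prod_eq_one, mul_one, map_pow,
      specialise_X, if_pos rfl, ← algebraMap_eq, AlgHom.commutes, PowerSeries.algebraMap_eq,
      PowerSeries.coeff_C_mul, PowerSeries.coeff_X_pow]
    · simp [eq_comm]
    · intro m hm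
      rw [map_pow, specialise_X, if_neg, one_pow]
      rintro rfl
      exact h1 hm
  simp only [hterm]
  have hsub : gammaIndex (n + 2) ⊆ (Finset.Icc 1 (n + 2)).piAntidiag (n + 2) :=
    Finset.filter_subset _ _
  -- `γ` vanishes off the index set, so the sum may run over all sequences of total `n`; those with
  -- first entry `j` then correspond to their tails.
  rw [Finset.sum_subset hsub (fun i _ hi => by rw [gammaCoeff_of_notMem hi, ite_self]),
    ← Finset.sum_filter]
  have hupd : ∀ (i : ℕ → ℕ) (a : ℕ), ∑ m ∈ Finset.Icc 2 (n + 2), Function.update i 1 a m =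
      ∑ m ∈ Finset.Icc 2 (n + 2), i m := by
    intro i a
    refine Finset.sum_congr rfl fun m hm => Function.update_of_ne ?_ _ _
    rintro rfl
    exact h1 hm
  refine Finset.sum_bij' (fun i _ => Function.update i 1 0) (fun i _ => Function.update i 1 j)
    ?_ ?_ ?_ ?_ ?_
  · intro i hi
    rw [Finset.mem_filter, Finset.mem_piAntidiag, hIcc, Finset.sum_insert h1] at hi
    rw [Finset.mem_piAntidiag, hupd]
    refine ⟨by omega, fun m hm => ?_⟩
    have hm1 : m ≠ 1 := by
      rintro rfl
      simp at hm
    rw [Function.update_of_ne hm1] at hm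
    exact Finset.mem_of_mem_insert_of_ne (hi.1.2 m hm) hm1
  · intro i hi
    rw [Finset.mem_piAntidiag] at hi
    rw [Finset.mem_filter, Finset.mem_piAntidiag, hIcc, Finset.sum_insert h1, hupd,
      Function.update_self]
    have hsum : ∑ m ∈ Finset.Icc 2 (n + 2), i m = n + 2 - j := hi.1
    refine ⟨⟨by omega, fun m hm => ?_⟩, rfl⟩
    by_cases hm1 : m = 1
    · exact hm1 ▸ Finset.mem_insert_self _ _
    · rw [Function.update_of_ne hm1] at hm
      exact Finset.mem_insert_of_mem (hi.2 m hm)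
  · intro i hi
    rw [Finset.mem_filter] at hi
    simp [← hi.2]
  · intro i hi
    rw [Finset.mem_piAntidiag] at hi
    have : i 1 = 0 := by
      by_contra h
      exact h1 (hi.2 1 h)
    simp [← this]
  · intro i hi
    rw [Finset.mem_filter] at hi
    simp [← hi.2]

/-! ### Uniqueness of the expansion. -/

/-- The exponent vector, in `e_1, …, e_{k+1}`, of `e_{k+2-m}`. -/
noncomputable def esymmExponent (k m : ℕ) : Fin (k + 1) →₀ ℕ :=
  if m ≤ k + 1 then Finsupp.single (Fin.ofNat (k + 1) (k + 1 - m)) 1 else 0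

lemma aeval_esymmExponent {k m : ℕ} (h1 : 1 ≤ m) (h2 : m ≤ k + 2) :
    aeval (fun i : Fin (k + 1) => esymm (Fin (k + 1)) ℤ (i + 1))
      (monomial (esymmExponent k m) (1 : ℤ)) = esymm (Fin (k + 1)) ℤ (k + 2 - m) := by
  rw [esymmExponent]
  split_ifs with h
  · rw [aeval_monomial]
    simp only [map_one, one_mul, Finsupp.prod_single_index, pow_zero, pow_one, Fin.val_ofNat]
    rw [Nat.mod_eq_of_lt (by omega)]
    congr 1
    omega
  · obtain rfl : m = k + 2 := by omega
    simp

lemma sum_smul_esymmExponent_apply {n k : ℕ} (i : ℕ → ℕ) {m : ℕ} (h1 : 1 ≤ m) (h2 : m ≤ k + 1)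
    (h3 : m ≤ n) :
    (∑ l ∈ Finset.Icc 1 n, i l • esymmExponent k l) (Fin.ofNat (k + 1) (k + 1 - m)) = i m := by
  rw [Finsupp.finsetSum_apply, Finset.sum_eq_single_of_mem m (Finset.mem_Icc.2 ⟨h1, h3⟩)]
  · simp [esymmExponent, h2]
  · intro l hl hne
    rw [Finset.mem_Icc] at hl
    rw [esymmExponent]
    split_ifs with h
    · rw [Finsupp.smul_apply, Finsupp.single_apply, if_neg, smul_zero]
      intro h'
      have := congrArg Fin.val h'
      simp only [Fin.val_ofNat] at this
      rw [Nat.mod_eq_of_lt (by omega), Nat.mod_eq_of_lt (by omega)] at this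
      omega
    · simp

/-- The exponents of `e_1, …, e_{k+1}` determine every entry with index at most `k + 1`. When `n = k
+ 2` the last factor is a power of `e_0 = 1` and leaves no trace, so `i_n` is recovered from the
total `n`. -/
lemma sum_smul_esymmExponent_injOn {n k : ℕ} (hk : n ≤ k + 2) :
    Set.InjOn (fun i : ℕ → ℕ => ∑ l ∈ Finset.Icc 1 n, i l • esymmExponent k l)
      (gammaIndex n : Set (ℕ → ℕ)) := by
  intro i hi i' hi' h
  have hi := (mem_gammaIndex.1 hi).1
  have hi' := (mem_gammaIndex.1 hi').1
  have key : ∀ m, m ≤ k + 1 → i m = i' m := by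
    intro m hm
    by_cases hmn : m ∈ Finset.Icc 1 n
    · rw [Finset.mem_Icc] at hmn
      have := DFunLike.congr_fun h (Fin.ofNat (k + 1) (k + 1 - m))
      simp only at this
      rwa [sum_smul_esymmExponent_apply i hmn.1 hm hmn.2,
        sum_smul_esymmExponent_apply i' hmn.1 hm hmn.2] at this
    · rw [not_ne_iff.1 (mt (hi.2 m) hmn), not_ne_iff.1 (mt (hi'.2 m) hmn)]
  funext m
  by_cases hm : m ≤ k + 1
  · exact key m hm
  by_cases hmn : m ∈ Finset.Icc 1 n
  · have e := hi.1
    have e' := hi'.1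
    rw [← Finset.add_sum_erase _ _ hmn] at e e'
    have : ∑ l ∈ (Finset.Icc 1 n).erase m, i l = ∑ l ∈ (Finset.Icc 1 n).erase m, i' l := by
      refine Finset.sum_congr rfl fun l hl => key l ?_
      simp only [Finset.mem_erase, Finset.mem_Icc] at hl hmn
      omega
    omega
  · rw [not_ne_iff.1 (mt (hi.2 m) hmn), not_ne_iff.1 (mt (hi'.2 m) hmn)]

/-- The elementary symmetric polynomials are algebraically independent, and distinct index sequences
give distinct monomials in them. -/
lemma IsGammaExpansion.unique {n k : ℕ} (hk : n ≤ k + 2) {γ γ' : (ℕ → ℕ) → ℤ}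
    (h : IsGammaExpansion n k γ) (h' : IsGammaExpansion n k γ') : γ = γ' := by
  let Φ := aeval (R := ℤ) (fun i : Fin (k + 1) => esymm (Fin (k + 1)) ℤ (i + 1))
  have hinj : Function.Injective Φ := by
    intro p q hpq
    refine esymmAlgHom_fin_injective ℤ (le_refl (k + 1)) (Subtype.ext ?_)
    rw [esymmAlgHom_apply, esymmAlgHom_apply]
    exact hpq
  let e : (ℕ → ℕ) → Fin (k + 1) →₀ ℕ := fun i => ∑ l ∈ Finset.Icc 1 n, i l • esymmExponent k l
  have hprod : ∀ i : ℕ → ℕ, ∏ m ∈ Finset.Icc 1 n, esymm (Fin (k + 1)) ℤ (k + 2 - m) ^ i m =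
      Φ (monomial (e i) 1) := by
    intro i
    rw [monomial_sum_one, map_prod]
    refine Finset.prod_congr rfl fun m hm => ?_
    rw [Finset.mem_Icc] at hm
    rw [← aeval_esymmExponent hm.1 (hm.2.trans hk), ← map_pow, monomial_pow, one_pow]
  have hsum : ∀ δ : (ℕ → ℕ) → ℤ, ∑ i ∈ gammaIndex n, C (δ i) *
      ∏ m ∈ Finset.Icc 1 n, esymm (Fin (k + 1)) ℤ (k + 2 - m) ^ i m =
        Φ (∑ i ∈ gammaIndex n, C (δ i) * monomial (e i) 1) := by
    intro δ
    rw [map_sum]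
    refine Finset.sum_congr rfl fun i _ => ?_
    rw [hprod, map_mul, ← algebraMap_eq, AlgHom.commutes]
  have heq := h.2.symm.trans h'.2
  rw [hsum, hsum] at heq
  have heq := hinj heq
  funext i
  by_cases hi : i ∈ gammaIndex n
  · have hc : ∀ δ : (ℕ → ℕ) → ℤ,
        coeff (e i) (∑ i ∈ gammaIndex n, C (δ i) * monomial (e i) 1) = δ i := by
      intro δ
      rw [coeff_sum, Finset.sum_eq_single_of_mem i hi]
      · rw [coeff_C_mul, coeff_monomial, if_pos rfl, mul_one]
      · intro l hl hne
        rw [coeff_C_mul, coeff_monomial, if_neg, mul_zero]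
        exact fun h => hne (sum_smul_esymmExponent_injOn hk hl hi h)
    rw [← hc γ, heq, hc]
  · rw [h.1 i hi, h'.1 i hi]

/-! ### Building Stirling permutations by inserting the block of largest letters. -/

lemma mem_stirlingPerms {n k : ℕ} {σ : List ℕ} :
    σ ∈ stirlingPerms n k ↔ (∀ a, σ.count a = if 1 ≤ a ∧ a ≤ n then k else 0) ∧
      ∀ a b, List.Sublist [a, b, a] σ → a ≤ b := by
  rw [stirlingPerms, Finset.mem_filter, Multiset.mem_toFinset, Multiset.mem_lists_iff]
  refine and_congr ?_ ⟨fun h a b hab => h a (hab.subset (by simp)) b (hab.subset (by simp)) hab,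
    fun h a _ b _ hab => h a b hab⟩
  change k • (Finset.Icc 1 n).val = (σ : Multiset ℕ) ↔ _
  rw [eq_comm, Multiset.ext]
  refine forall_congr' fun a => ?_
  rw [Multiset.coe_count, Multiset.count_nsmul, Multiset.count_eq_of_nodup (Finset.Icc 1 n).nodup]
  simp only [Finset.mem_val, Finset.mem_Icc, mul_ite, mul_one, mul_zero]

lemma mem_of_mem_stirlingPerms {n k : ℕ} {σ : List ℕ} (hσ : σ ∈ stirlingPerms n k) {a : ℕ}
    (ha : a ∈ σ) : 1 ≤ a ∧ a ≤ n := by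
  by_contra h
  have := (mem_stirlingPerms.1 hσ).1 a
  rw [if_neg h] at this
  exact List.count_eq_zero.1 this ha

/-- The word obtained from `σ` by inserting `k` copies of `M` after the first `p` letters. -/
def insertBlock (k M : ℕ) (σ : List ℕ) (p : ℕ) : List ℕ :=
  σ.take p ++ (List.replicate k M ++ σ.drop p)

lemma insertBlock_append (k M : ℕ) (A B : List ℕ) :
    insertBlock k M (A ++ B) A.length = A ++ (List.replicate k M ++ B) := by
  simp [insertBlock]

lemma length_insertBlock (k M : ℕ) (σ : List ℕ) (p : ℕ) :
    (insertBlock k M σ p).length = σ.length + k := by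
  simp only [insertBlock, List.length_append, List.length_take, List.length_replicate,
    List.length_drop]
  omega

lemma count_insertBlock (k M : ℕ) (σ : List ℕ) (p a : ℕ) :
    (insertBlock k M σ p).count a = σ.count a + if M = a then k else 0 := by
  conv_rhs => rw [← List.take_append_drop p σ]
  simp only [insertBlock, List.count_append, List.count_replicate, beq_iff_eq]
  omega

lemma filter_block {k M : ℕ} {A B : List ℕ} (hA : M ∉ A) (hB : M ∉ B) :
    (A ++ (List.replicate k M ++ B)).filter (· ≠ M) = A ++ B := by
  have h : ∀ L : List ℕ, M ∉ L → L.filter (· ≠ M) = L := fun L hL =>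
    List.filter_eq_self.2 fun a ha => by
      simp only [decide_eq_true_eq]
      rintro rfl
      exact hL ha
  rw [List.filter_append, List.filter_append, h A hA, h B hB]
  simp

lemma idxOf_block {k M : ℕ} (hk : 1 ≤ k) {A B : List ℕ} (hA : M ∉ A) :
    (A ++ (List.replicate k M ++ B)).idxOf M = A.length := by
  obtain ⟨k, rfl⟩ : ∃ t, k = t + 1 := ⟨k - 1, by omega⟩
  rw [List.idxOf_append_of_notMem hA, List.replicate_succ, List.cons_append,
    List.idxOf_cons_self, add_zero]

lemma cons_sublist_append_of_notMem {M : ℕ} {A B L : List ℕ} (hA : M ∉ A)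
    (h : List.Sublist (M :: L) (A ++ B)) : List.Sublist (M :: L) B := by
  induction A with
  | nil => exact h
  | cons a A ih =>
    simp only [List.mem_cons, not_or] at hA
    rw [List.cons_append, List.sublist_cons_iff] at h
    rcases h with h | ⟨r, hr, -⟩
    · exact ih hA.2 h
    · exact absurd (List.cons.inj hr).1 hA.1

/-- The first `M` lies beyond `A` and, reading backwards, the last lies before `B`, so `b` is inside
the block. -/
lemma eq_of_sublist_block {k M b : ℕ} {A B : List ℕ} (hA : M ∉ A) (hB : M ∉ B)
    (h : List.Sublist [M, b, M] (A ++ (List.replicate k M ++ B))) : b = M := by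
  have h1 := (cons_sublist_append_of_notMem hA h).reverse
  rw [List.reverse_append] at h1
  have h2 := cons_sublist_append_of_notMem (L := [b, M]) (by simpa using hB) h1
  rw [List.reverse_replicate] at h2
  exact List.eq_of_mem_replicate (h2.subset (show b ∈ [M, b, M] by simp))

lemma exists_block {M : ℕ} {τ : List ℕ} (hM : M ∈ τ)
    (h : ∀ b, List.Sublist [M, b, M] τ → b = M) :
    ∃ A B, M ∉ A ∧ M ∉ B ∧ τ = A ++ (List.replicate (τ.count M) M ++ B) := by
  obtain ⟨A, R, rfl, hA⟩ := List.eq_append_cons_of_mem hM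
  have hR : ∃ c B, M ∉ B ∧ R = List.replicate c M ++ B := by
    have h' : ∀ b, List.Sublist [b, M] R → b = M := fun b hb =>
      h b ((hb.cons_cons M).trans (List.sublist_append_right _ _))
    clear h hM
    induction R with
    | nil => exact ⟨0, [], by simp, rfl⟩
    | cons b R ih =>
      by_cases hb : b = M
      · obtain ⟨c, B, hB, rfl⟩ := ih fun b' hb' => h' b' (hb'.cons b)
        exact ⟨c + 1, B, hB, by rw [hb, List.replicate_succ, List.cons_append]⟩
      · refine ⟨0, b :: R, fun hmem => ?_, rfl⟩
        rcases List.mem_cons.1 hmem with h1 | h1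
        · exact hb h1.symm
        · exact hb (h' b ((List.singleton_sublist.2 h1).cons_cons b))
  obtain ⟨c, B, hB, rfl⟩ := hR
  refine ⟨A, B, hA, hB, ?_⟩
  have : List.count M (A ++ M :: (List.replicate c M ++ B)) = c + 1 := by
    simp [List.count_append, List.count_eq_zero.2 hA, List.count_eq_zero.2 hB]
  rw [this, List.replicate_succ, List.cons_append]

lemma notMem_of_mem_stirlingPerms {n k : ℕ} {σ : List ℕ} (hσ : σ ∈ stirlingPerms n k) :
    n + 1 ∉ σ := fun h => by
  have := mem_of_mem_stirlingPerms hσ h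
  omega

lemma insertBlock_mem {n k : ℕ} {σ : List ℕ} (hσ : σ ∈ stirlingPerms n k) (p : ℕ) :
    insertBlock k (n + 1) σ p ∈ stirlingPerms (n + 1) k := by
  have hM := notMem_of_mem_stirlingPerms hσ
  have hA : n + 1 ∉ σ.take p := fun h => hM (List.mem_of_mem_take h)
  have hB : n + 1 ∉ σ.drop p := fun h => hM (List.mem_of_mem_drop h)
  have hcount : ∀ a, (insertBlock k (n + 1) σ p).count a =
      if 1 ≤ a ∧ a ≤ n + 1 then k else 0 := by
    intro a
    rw [count_insertBlock, (mem_stirlingPerms.1 hσ).1]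
    split_ifs <;> omega
  refine mem_stirlingPerms.2 ⟨hcount, fun a b hab => ?_⟩
  have hle : ∀ c ∈ insertBlock k (n + 1) σ p, c ≤ n + 1 := by
    intro c hc
    by_contra hlt
    have h0 := hcount c
    rw [if_neg (by omega)] at h0
    exact List.count_eq_zero.1 h0 hc
  by_cases ha : a = n + 1
  · subst ha
    exact (eq_of_sublist_block hA hB hab).ge
  by_cases hb : b = n + 1
  · exact hb ▸ hle a (hab.subset (by simp))
  -- Deleting the letters `n + 1` restores `σ` and keeps the pattern, as neither `a` nor `b` is
  -- deleted.
  · have h := hab.filter (· ≠ n + 1)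
    rw [insertBlock, filter_block hA hB, List.take_append_drop] at h
    refine (mem_stirlingPerms.1 hσ).2 a b ?_
    simpa [ha, hb] using h

lemma exists_block_of_mem {n k : ℕ} (hk : 1 ≤ k) {τ : List ℕ}
    (hτ : τ ∈ stirlingPerms (n + 1) k) :
    ∃ A B, n + 1 ∉ A ∧ n + 1 ∉ B ∧ τ = A ++ (List.replicate k (n + 1) ++ B) ∧
      A ++ B ∈ stirlingPerms n k := by
  have hc := (mem_stirlingPerms.1 hτ).1
  have hcM := hc (n + 1)
  rw [if_pos (by omega)] at hcM
  have hM : n + 1 ∈ τ := List.count_pos_iff.1 (by omega)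
  obtain ⟨A, B, hA, hB, h⟩ := exists_block hM fun b hb =>
    le_antisymm (mem_of_mem_stirlingPerms hτ (hb.subset (by simp))).2
      ((mem_stirlingPerms.1 hτ).2 _ _ hb)
  rw [hcM] at h
  refine ⟨A, B, hA, hB, h, mem_stirlingPerms.2 ⟨fun a => ?_, fun a b hab => ?_⟩⟩
  · have h1 := hc a
    rw [h, ← insertBlock_append, count_insertBlock] at h1
    by_cases ha : n + 1 = a
    · subst ha
      rw [if_neg (by omega), List.count_eq_zero]
      simp [hA, hB]
    · rw [if_neg ha, add_zero] at h1
      rw [h1]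
      split_ifs <;> omega
  · refine (mem_stirlingPerms.1 hτ).2 a b (hab.trans ?_)
    rw [h]
    exact (List.sublist_append_right _ _).append_left A

/-- The copies of the largest letter are contiguous, so insertion is a bijection. Its inverse
deletes them and records where the first one stood, which needs `k ≥ 1`. -/
lemma sum_stirlingPerms_succ {R : Type*} [AddCommMonoid R] {n k : ℕ} (hk : 1 ≤ k)
    (g : List ℕ → R) :
    ∑ τ ∈ stirlingPerms (n + 1) k, g τ =
      ∑ σ ∈ stirlingPerms n k, ∑ p ∈ Finset.range (σ.length + 1),
        g (insertBlock k (n + 1) σ p) := by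
  rw [Finset.sum_sigma']
  symm
  refine Finset.sum_bij' (fun x _ => insertBlock k (n + 1) x.1 x.2)
    (fun τ _ => ⟨τ.filter (· ≠ n + 1), τ.idxOf (n + 1)⟩) ?_ ?_ ?_ ?_ ?_
  · rintro ⟨σ, p⟩ h
    exact insertBlock_mem (Finset.mem_sigma.1 h).1 p
  · intro τ hτ
    obtain ⟨A, B, hA, hB, rfl, hAB⟩ := exists_block_of_mem hk hτ
    rw [filter_block hA hB, idxOf_block hk hA, Finset.mem_sigma, Finset.mem_range,
      List.length_append]
    exact ⟨hAB, by dsimp only; omega⟩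
  · rintro ⟨σ, p⟩ h
    rw [Finset.mem_sigma, Finset.mem_range] at h
    have hM := notMem_of_mem_stirlingPerms h.1
    have hA : n + 1 ∉ σ.take p := fun h => hM (List.mem_of_mem_take h)
    have hB : n + 1 ∉ σ.drop p := fun h => hM (List.mem_of_mem_drop h)
    simp only at h
    simp only [insertBlock]
    rw [filter_block hA hB, idxOf_block hk hA, List.take_append_drop, List.length_take,
      min_eq_left (by omega)]
  · intro τ hτ
    obtain ⟨A, B, hA, hB, rfl, hAB⟩ := exists_block_of_mem hk hτ
    rw [filter_block hA hB, idxOf_block hk hA, insertBlock_append]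
  · intro x hx
    rfl

/-! ### Effect of an insertion on the labels of the gaps. -/

lemma letter_zero (σ : List ℕ) : letter σ 0 = 0 := by simp [letter]

lemma letter_succ (σ : List ℕ) (i : ℕ) : letter σ (i + 1) = σ.getD i 0 := by simp [letter]

lemma letter_of_length_lt {σ : List ℕ} {i : ℕ} (h : σ.length < i) : letter σ i = 0 := by
  obtain ⟨i, rfl⟩ : ∃ t, i = t + 1 := ⟨i - 1, by omega⟩
  rw [letter_succ, List.getD_eq_default _ _ (by omega)]

lemma letter_mem {σ : List ℕ} {i : ℕ} (h1 : 1 ≤ i) (h2 : i ≤ σ.length) : letter σ i ∈ σ := by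
  obtain ⟨i, rfl⟩ : ∃ t, i = t + 1 := ⟨i - 1, by omega⟩
  rw [letter_succ, List.getD_eq_getElem _ _ (by omega)]
  exact List.getElem_mem _

lemma letter_lt {σ : List ℕ} {M : ℕ} (hM : 0 < M) (h : ∀ a ∈ σ, a < M) (i : ℕ) :
    letter σ i < M := by
  rcases Nat.eq_zero_or_pos i with rfl | hi
  · rwa [letter_zero]
  · by_cases h2 : i ≤ σ.length
    · exact h _ (letter_mem hi h2)
    · rwa [letter_of_length_lt (by omega)]

section insertBlock

variable {k M : ℕ} {σ : List ℕ} {p : ℕ}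

lemma letter_insertBlock_of_le (hp : p ≤ σ.length) {i : ℕ} (hi : i ≤ p) :
    letter (insertBlock k M σ p) i = letter σ i := by
  cases i with
  | zero => rw [letter_zero, letter_zero]
  | succ i =>
    rw [letter_succ, letter_succ, insertBlock, List.getD_append _ _ _ _ (by simp; omega)]
    simp only [List.getD_eq_getElem?_getD, List.getElem?_take]
    rw [if_pos (by omega)]

lemma letter_insertBlock_block (hp : p ≤ σ.length) {t : ℕ} (ht : t < k) :
    letter (insertBlock k M σ p) (p + 1 + t) = M := by
  rw [show p + 1 + t = (p + t) + 1 by ring, letter_succ, insertBlock,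
    List.getD_append_right _ _ _ _ (by simp), List.length_take, min_eq_left hp,
    Nat.add_sub_cancel_left, List.getD_append _ _ _ _ (by simpa using ht),
    List.getD_eq_getElem _ _ (by simpa using ht), List.getElem_replicate]

lemma letter_insertBlock_right (hp : p ≤ σ.length) (s : ℕ) :
    letter (insertBlock k M σ p) (p + 1 + s + k) = letter σ (p + 1 + s) := by
  rw [show p + 1 + s + k = (p + (k + s)) + 1 by ring, show p + 1 + s = (p + s) + 1 by ring,
    letter_succ, letter_succ, insertBlock,
    List.getD_append_right _ _ _ _ (by simp), List.length_take, min_eq_left hp,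
    Nat.add_sub_cancel_left, List.getD_append_right _ _ _ _ (by simp), List.length_replicate,
    Nat.add_sub_cancel_left]
  simp only [List.getD_eq_getElem?_getD, List.getElem?_drop]

end insertBlock

/-- The index of the variable marking the position `i`, counted from `0`. -/
def label (k : ℕ) (σ : List ℕ) (i : ℕ) : ℕ :=
  if letter σ i < letter σ (i + 1) then k
  else if letter σ (i + 1) < letter σ i then k - 1
  else ((Finset.Ico 1 i).filter fun l => letter σ l = letter σ i).card

section label

variable {k M : ℕ} {σ : List ℕ} {p : ℕ}

lemma label_insertBlock_left (hp : p ≤ σ.length) {i : ℕ} (hi : i < p) :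
    label k (insertBlock k M σ p) i = label k σ i := by
  rw [label, label, letter_insertBlock_of_le hp hi.le, letter_insertBlock_of_le hp hi]
  congr 3
  refine Finset.filter_congr fun l hl => ?_
  rw [letter_insertBlock_of_le hp ((Finset.mem_Ico.1 hl).2.le.trans hi.le)]

lemma label_insertBlock_asc (hk : 1 ≤ k) (hp : p ≤ σ.length) (hM : ∀ i, letter σ i < M) :
    label k (insertBlock k M σ p) p = k := by
  rw [label, letter_insertBlock_of_le hp le_rfl,
    show p + 1 = p + 1 + 0 from rfl, letter_insertBlock_block hp hk, if_pos (hM p)]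

lemma label_insertBlock_plat (hp : p ≤ σ.length) (hM : ∀ i, letter σ i < M) {t : ℕ}
    (ht : t + 1 < k) : label k (insertBlock k M σ p) (p + 1 + t) = t := by
  rw [label, letter_insertBlock_block hp (by omega), add_assoc (p + 1) t 1,
    letter_insertBlock_block hp ht, if_neg (lt_irrefl M), if_neg (lt_irrefl M)]
  have : (Finset.Ico 1 (p + 1 + t)).filter (fun l => letter (insertBlock k M σ p) l = M) =
      Finset.Ico (p + 1) (p + 1 + t) := by
    ext l
    rw [Finset.mem_filter, Finset.mem_Ico, Finset.mem_Ico]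
    refine ⟨fun h => ⟨?_, h.1.2⟩, fun h => ⟨⟨by omega, h.2⟩, ?_⟩⟩
    · by_contra hl
      have h2 := h.2
      rw [letter_insertBlock_of_le hp (by omega)] at h2
      exact (hM l).ne h2
    · obtain ⟨u, rfl⟩ := Nat.exists_eq_add_of_le h.1
      exact letter_insertBlock_block hp (by omega)
  rw [this, Nat.card_Ico]
  omega

lemma label_insertBlock_des (hk : 1 ≤ k) (hp : p ≤ σ.length) (hM : ∀ i, letter σ i < M) :
    label k (insertBlock k M σ p) (p + k) = k - 1 := by
  have h1 : letter (insertBlock k M σ p) (p + k) = M := by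
    rw [show p + k = p + 1 + (k - 1) by omega]
    exact letter_insertBlock_block hp (by omega)
  have h2 : letter (insertBlock k M σ p) (p + k + 1) = letter σ (p + 1) := by
    rw [show p + k + 1 = p + 1 + 0 + k by ring]
    exact letter_insertBlock_right hp 0
  have := hM (p + 1)
  rw [label, h1, h2, if_neg (by omega), if_pos this]

lemma label_insertBlock_right (hp : p ≤ σ.length) (hM : ∀ i, letter σ i < M) (s : ℕ) :
    label k (insertBlock k M σ p) (p + 1 + s + k) = label k σ (p + 1 + s) := by
  rw [label, label, letter_insertBlock_right hp, add_right_comm _ k 1, add_assoc (p + 1) s 1,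
    letter_insertBlock_right hp]
  congr 2
  generalize ha : letter σ (p + 1 + s) = a
  have haM : M ≠ a := ha ▸ (hM _).ne'
  simp only [Finset.card_filter]
  -- Earlier copies of `a` are counted left of, inside and right of the block; the block holds none,
  -- since `M ≠ a`.
  rw [← Finset.sum_Ico_consecutive _ (show 1 ≤ p + 1 by omega)
      (show p + 1 ≤ p + 1 + s + k by omega),
    ← Finset.sum_Ico_consecutive _ (show p + 1 ≤ p + 1 + k by omega)
      (show p + 1 + k ≤ p + 1 + s + k by omega),
    ← Finset.sum_Ico_consecutive _ (show 1 ≤ p + 1 by omega)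
      (show p + 1 ≤ p + 1 + s by omega)]
  have e1 : ∑ i ∈ Finset.Ico (p + 1) (p + 1 + k),
      (if letter (insertBlock k M σ p) i = a then 1 else 0) = 0 := by
    refine Finset.sum_eq_zero fun i hi => ?_
    rw [Finset.mem_Ico] at hi
    obtain ⟨u, rfl⟩ := Nat.exists_eq_add_of_le hi.1
    rw [letter_insertBlock_block hp (by omega), if_neg haM]
  rw [e1, zero_add, ← Finset.sum_Ico_add' _ (p + 1) (p + 1 + s) k]
  congr 1
  · refine Finset.sum_congr rfl fun i hi => ?_
    rw [letter_insertBlock_of_le hp (by have := Finset.mem_Ico.1 hi; omega)]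
  · refine Finset.sum_congr rfl fun i hi => ?_
    rw [Finset.mem_Ico] at hi
    obtain ⟨u, rfl⟩ := Nat.exists_eq_add_of_le hi.1
    rw [letter_insertBlock_right hp]

/-- Gap `p` is replaced by an ascent (label `k`), plateaux (labels `0, …, k - 2`) and a descent
(label `k - 1`). All other gaps keep their labels. -/
lemma prod_label_insertBlock {R : Type*} [CommMonoid R] (hk : 1 ≤ k) (hp : p ≤ σ.length)
    (hM : ∀ i, letter σ i < M) (f : ℕ → R) :
    ∏ i ∈ Finset.range ((insertBlock k M σ p).length + 1), f (label k (insertBlock k M σ p) i) =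
      (∏ m ∈ Finset.range (k + 1), f m) *
        ∏ i ∈ (Finset.range (σ.length + 1)).erase p, f (label k σ i) := by
  obtain ⟨q, hq⟩ := Nat.exists_eq_add_of_le hp
  obtain ⟨c, rfl⟩ : ∃ t, k = t + 1 := ⟨k - 1, by omega⟩
  have herase : ∏ i ∈ (Finset.range (σ.length + 1)).erase p, f (label (c + 1) σ i) =
      (∏ i ∈ Finset.range p, f (label (c + 1) σ i)) *
        ∏ s ∈ Finset.range q, f (label (c + 1) σ (p + 1 + s)) := by
    have hdisj : (Finset.range (σ.length + 1)).erase p =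
        (Finset.range p).disjUnion (Finset.Ico (p + 1) (p + 1 + q))
          (Finset.disjoint_left.2 fun x hx hx' => by
            rw [Finset.mem_range] at hx
            rw [Finset.mem_Ico] at hx'
            omega) := by
      ext x
      simp only [Finset.mem_erase, Finset.mem_range, Finset.mem_disjUnion, Finset.mem_Ico]
      omega
    rw [hdisj, Finset.prod_disjUnion, Finset.prod_Ico_eq_prod_range, Nat.add_sub_cancel_left]
  -- The summands are the left gaps, the ascent, the `k - 1` plateaux, the descent and the right
  -- gaps.
  rw [herase, length_insertBlock, show σ.length + (c + 1) + 1 = p + (1 + (c + (1 + q))) by omega,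
    Finset.prod_range_add, Finset.prod_range_add, Finset.prod_range_add, Finset.prod_range_add,
    Finset.prod_range_one, Finset.prod_range_one, Finset.prod_range_succ _ (c + 1),
    Finset.prod_range_succ _ c]
  simp only [add_zero, ← add_assoc]
  rw [label_insertBlock_asc hk hp hM, show p + 1 + c = p + (c + 1) by ring,
    label_insertBlock_des hk hp hM, Nat.add_sub_cancel]
  have h1 : ∏ i ∈ Finset.range p, f (label (c + 1) (insertBlock (c + 1) M σ p) i) =
      ∏ i ∈ Finset.range p, f (label (c + 1) σ i) :=
    Finset.prod_congr rfl fun i hi => by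
      rw [label_insertBlock_left hp (Finset.mem_range.1 hi)]
  have h2 : ∏ t ∈ Finset.range c, f (label (c + 1) (insertBlock (c + 1) M σ p) (p + 1 + t)) =
      ∏ t ∈ Finset.range c, f t :=
    Finset.prod_congr rfl fun t ht => by
      rw [label_insertBlock_plat hp hM (by have := Finset.mem_range.1 ht; omega)]
  have h3 : ∏ s ∈ Finset.range q,
      f (label (c + 1) (insertBlock (c + 1) M σ p) (p + (c + 1) + 1 + s)) =
      ∏ s ∈ Finset.range q, f (label (c + 1) σ (p + 1 + s)) :=
    Finset.prod_congr rfl fun s _ => by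
      rw [show p + (c + 1) + 1 + s = p + 1 + s + (c + 1) by ring, label_insertBlock_right hp hM]
  rw [h1, h2, h3]
  simp only [mul_comm, mul_left_comm, mul_assoc]

end label

lemma count_eq_card_filter (σ : List ℕ) (a : ℕ) :
    σ.count a = ((Finset.Ico 1 (σ.length + 1)).filter fun l => letter σ l = a).card := by
  rw [Finset.card_filter, Finset.sum_Ico_eq_sum_range, Nat.add_sub_cancel]
  simp only [add_comm 1, letter_succ]
  induction σ with
  | nil => simp
  | cons b σ ih =>
    rw [List.length_cons, Finset.sum_range_succ', List.count_cons, ih]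
    simp

section mem

variable {n k : ℕ} {σ : List ℕ}

/-- The earlier copies, together with positions `i` and `i + 1`, are distinct occurrences of a
letter that appears at most `k` times. The case `n = 0` is excluded because the empty word has the
spurious plateau `0 = 0`. -/
lemma plateau_bound (hn : 1 ≤ n) (hk : 1 ≤ k) (hσ : σ ∈ stirlingPerms n k) {i : ℕ}
    (hi : i ≤ σ.length) (h : letter σ i = letter σ (i + 1)) :
    ((Finset.Ico 1 i).filter fun l => letter σ l = letter σ i).card + 2 ≤ k := by
  have hlen : 1 ≤ σ.length := by
    have h1 := (mem_stirlingPerms.1 hσ).1 1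
    rw [if_pos ⟨le_rfl, hn⟩] at h1
    exact List.length_pos_of_mem (List.count_pos_iff.1 (by omega : 0 < σ.count 1))
  have hpos : ∀ j, 1 ≤ j → j ≤ σ.length → 1 ≤ letter σ j := fun j h1 h2 =>
    (mem_of_mem_stirlingPerms hσ (letter_mem h1 h2)).1
  have hi1 : 1 ≤ i := by
    by_contra h0
    obtain rfl : i = 0 := by omega
    rw [letter_zero, zero_add] at h
    have := hpos 1 le_rfl hlen
    omega
  have hi2 : i + 1 ≤ σ.length := by
    by_contra h0
    rw [letter_of_length_lt (by omega : σ.length < i + 1)] at h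
    have := hpos i hi1 hi
    omega
  have hc : σ.count (letter σ i) ≤ k := by
    rw [(mem_stirlingPerms.1 hσ).1]
    split_ifs <;> omega
  rw [count_eq_card_filter] at hc
  refine le_trans ?_ hc
  have hnot1 : i + 1 ∉ (Finset.Ico 1 i).filter fun l => letter σ l = letter σ i := by simp
  have hnot2 : i ∉ insert (i + 1) ((Finset.Ico 1 i).filter fun l => letter σ l = letter σ i) := by
    simp
  have hcard := Finset.card_insert_of_notMem hnot2
  rw [Finset.card_insert_of_notMem hnot1] at hcard
  refine hcard.symm.le.trans ?_
  refine Finset.card_le_card fun l hl => ?_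
  simp only [Finset.mem_insert, Finset.mem_filter, Finset.mem_Ico] at hl ⊢
  rcases hl with rfl | rfl | hl
  · exact ⟨by omega, rfl⟩
  · exact ⟨by omega, h.symm⟩
  · exact ⟨by omega, hl.2⟩

lemma label_le (hn : 1 ≤ n) (hk : 1 ≤ k) (hσ : σ ∈ stirlingPerms n k) {i : ℕ}
    (hi : i ≤ σ.length) : label k σ i ≤ k := by
  rw [label]
  split_ifs with h1 h2
  · exact le_rfl
  · omega
  · have := plateau_bound hn hk hσ hi (by omega)
    omega

/-- By `plateau_bound`, plateau labels are at most `k - 2` and cannot collide with those of descents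
and ascents. -/
lemma statistic_eq_card_label (hn : 1 ≤ n) (hk : 1 ≤ k) (hσ : σ ∈ stirlingPerms n k) (m : ℕ) :
    (if m = k then asc σ else if m + 1 = k then des σ else plat (m + 1) σ) =
      if m ≤ k then
        ((Finset.range (σ.length + 1)).filter fun i => label k σ i = m).card
      else plat (m + 1) σ := by
  by_cases hm : m ≤ k
  swap
  · rw [if_neg (by omega), if_neg (by omega), if_neg hm]
  rw [if_pos hm]
  split_ifs with h1 h2
  all_goals
    first | rw [asc] | rw [des] | rw [plat]
    refine congrArg Finset.card (Finset.filter_congr fun i hi => ?_)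
    have hb := plateau_bound hn hk hσ (Nat.lt_succ_iff.1 (Finset.mem_range.1 hi))
    rw [label]
    split_ifs with h3 h4 <;> omega

end mem

/-! ### The recurrence for the Eulerian polynomials and the conclusion. -/

/-- The variable `x_{m+1}`, with the convention that it is `0` for `m > k`. -/
noncomputable def variableAt (k m : ℕ) : MvPolynomial (Fin (k + 1)) ℤ :=
  if h : m < k + 1 then X ⟨m, h⟩ else 0

lemma totalDeriv_variableAt {k m : ℕ} (h : m ≤ k) :
    totalDeriv (Fin (k + 1)) (variableAt k m) = 1 := by
  rw [variableAt, dif_pos (Nat.lt_succ_of_le h), totalDeriv_X]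

lemma prod_variableAt (k : ℕ) :
    ∏ m ∈ Finset.range (k + 1), variableAt k m = esymm (Fin (k + 1)) ℤ (k + 1) := by
  have h : esymm (Fin (k + 1)) ℤ (k + 1) = ∏ i : Fin (k + 1), X i := by
    have h1 : Finset.powersetCard (k + 1) (Finset.univ : Finset (Fin (k + 1))) =
        {Finset.univ} := by
      have h2 := Finset.powersetCard_self (Finset.univ : Finset (Fin (k + 1)))
      rwa [Finset.card_fin] at h2
    rw [esymm, h1, Finset.sum_singleton]
  rw [h, ← Fin.prod_univ_eq_prod_range]
  refine Finset.prod_congr rfl fun i _ => ?_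
  rw [variableAt, dif_pos i.2]

lemma eulerianPoly_eq_sum_prod_label {n k : ℕ} (hn : 1 ≤ n) (hk : 1 ≤ k) :
    eulerianPoly n k = ∑ σ ∈ stirlingPerms n k,
      ∏ i ∈ Finset.range (σ.length + 1), variableAt k (label k σ i) := by
  refine Finset.sum_congr rfl fun σ hσ => ?_
  rw [← Finset.prod_fiberwise_of_maps_to (t := Finset.range (k + 1)) (g := fun i => label k σ i)
    fun i hi => Finset.mem_range.2 (Nat.lt_succ_of_le
      (label_le hn hk hσ (Nat.lt_succ_iff.1 (Finset.mem_range.1 hi)))), Finset.prod_range]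
  refine Finset.prod_congr rfl fun m _ => ?_
  rw [statistic_eq_card_label hn hk hσ, if_pos (Nat.lt_succ_iff.1 m.2), ← Finset.prod_const]
  refine Finset.prod_congr rfl fun i hi => ?_
  rw [(Finset.mem_filter.1 hi).2, variableAt, dif_pos m.2]

lemma prod_label_insertBlock_of_mem {n k : ℕ} (hk : 1 ≤ k) {σ : List ℕ}
    (hσ : σ ∈ stirlingPerms n k) {p : ℕ} (hp : p ∈ Finset.range (σ.length + 1)) :
    ∏ i ∈ Finset.range ((insertBlock k (n + 1) σ p).length + 1),
        variableAt k (label k (insertBlock k (n + 1) σ p) i) =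
      esymm (Fin (k + 1)) ℤ (k + 1) *
        ∏ i ∈ (Finset.range (σ.length + 1)).erase p, variableAt k (label k σ i) := by
  rw [prod_label_insertBlock hk (Nat.lt_succ_iff.1 (Finset.mem_range.1 hp)) _ (variableAt k),
    prod_variableAt]
  exact letter_lt n.succ_pos fun a ha => Nat.lt_succ_of_le (mem_of_mem_stirlingPerms hσ ha).2

lemma eulerianPoly_one {k : ℕ} (hk : 1 ≤ k) :
    eulerianPoly 1 k = esymm (Fin (k + 1)) ℤ (k + 1) := by
  have h0 : stirlingPerms 0 k = {[]} := by
    ext σ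
    rw [Finset.mem_singleton]
    constructor
    · intro h
      refine List.eq_nil_iff_forall_not_mem.2 fun a ha => ?_
      have := mem_of_mem_stirlingPerms h ha
      omega
    · rintro rfl
      refine mem_stirlingPerms.2 ⟨fun a => ?_, fun a b h => by simp at h⟩
      rw [if_neg (by omega), List.count_nil]
  have hmem : ([] : List ℕ) ∈ stirlingPerms 0 k := by simp [h0]
  rw [eulerianPoly_eq_sum_prod_label le_rfl hk, sum_stirlingPerms_succ hk, h0,
    Finset.sum_singleton, List.length_nil, zero_add, Finset.sum_range_one,
    prod_label_insertBlock_of_mem hk hmem (by simp)]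
  simp

/-- The Leibniz rule erases one gap variable at a time, which is what insertion into that gap does,
up to the factor `e_{k+1}`. -/
lemma eulerianPoly_succ {n k : ℕ} (hn : 1 ≤ n) (hk : 1 ≤ k) :
    eulerianPoly (n + 1) k =
      esymm (Fin (k + 1)) ℤ (k + 1) * totalDeriv (Fin (k + 1)) (eulerianPoly n k) := by
  rw [eulerianPoly_eq_sum_prod_label (by omega) hk, eulerianPoly_eq_sum_prod_label hn hk,
    sum_stirlingPerms_succ hk, map_sum, Finset.mul_sum]
  refine Finset.sum_congr rfl fun σ hσ => ?_
  rw [Derivation.map_finset_prod, Finset.mul_sum]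
  refine Finset.sum_congr rfl fun p hp => ?_
  rw [prod_label_insertBlock_of_mem hk hσ hp, totalDeriv_variableAt
    (label_le hn hk hσ (Nat.lt_succ_iff.1 (Finset.mem_range.1 hp))), mul_one]

lemma eulerianPoly_succ_eq_toEsymm (n : ℕ) {k : ℕ} (hk : 1 ≤ k) :
    eulerianPoly (n + 1) k = toEsymm k (gammaPoly n) := by
  induction n with
  | zero => rw [eulerianPoly_one hk, gammaPoly_zero, toEsymm_X, if_pos (by omega)]; rfl
  | succ n ih => rw [eulerianPoly_succ (by omega) hk, ih, gammaPoly_succ, toEsymm_grammarDeriv]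

lemma isGammaExpansion_gammaCoeff {n k : ℕ} (hn : 2 ≤ n) (hk : 1 ≤ k) (hnk : n ≤ k + 2) :
    IsGammaExpansion n k (gammaCoeff n) := by
  refine ⟨fun i hi => gammaCoeff_of_notMem hi, ?_⟩
  rw [← toEsymm_gammaPoly hn hnk, ← eulerianPoly_succ_eq_toEsymm _ hk, Nat.sub_add_cancel
    (by omega)]

end StirlingGamma

theorem corollary4p6 (n : ℕ) (hn : 2 ≤ n) :
    ∃ γ : (ℕ → ℕ) → ℤ,
      (∀ k : ℕ, 1 ≤ k → n - 2 ≤ k →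
        ∀ γ' : (ℕ → ℕ) → ℤ, StirlingGamma.IsGammaExpansion n k γ' ↔ γ' = γ) ∧
      ∀ j : ℕ, 1 ≤ j → j ≤ n - 1 →
        StirlingGamma.secondOrderEulerian (n - 1) j =
          ∑ i ∈ (Finset.Icc 2 n).piAntidiag (n - j), γ (Function.update i 1 j) := by
  refine ⟨StirlingGamma.gammaCoeff n, fun k hk hnk γ' => ⟨fun h => ?_, ?_⟩, fun j _ hj =>
    StirlingGamma.secondOrderEulerian_eq_sum hn hj⟩
  · exact h.unique (by omega) (StirlingGamma.isGammaExpansion_gammaCoeff hn hk (by omega))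
  · rintro rfl
    exact StirlingGamma.isGammaExpansion_gammaCoeff hn hk (by omega)
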